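/- Notation. For a finite discrete alphabet $A$ and $M\in\{\mathbb N,\mathbb Z\}$ (with $0\in\mathbb N$), let $(\sigma x)_m=x_{m+1}$ on $A^M$ (product topology). A substitution is a map $\tau:A\to A^+$ into nonempty words, extended by concatenation to words and to one-sided sequences. Let $\mathcal L_\tau$ be the set of subwords of the words $\tau^n(a)$ ($n\ge1$, $a\in A$), and $X^M_\tau\subseteq A^M$ the set of sequences all of whose words lie in $\mathcal L_\tau$. Call $\tau$ minimal if it has a fixed point $v\in A^{\mathbb N}$, $\tau(v)=v$, whose set of words is $\mathcal L_\tau$ and with $|\tau^n(v_0)|\to\infty$, and if every forward $\sigma$-orbit is dense in $X^{\mathbb N}_\tau$. A branch point of a system $(Y,T)$ is a point that does not have exactly one $T$-preimage; it is a $k$-branch point if it has exactly $k$ preimages. $(Y,T)$ is quasi-invertible if it has exactly one branch point. Two systems are conjugate if there is a homeomorphism between them that intertwines the maps. Statement. Let $\tau$ be the substitution on $\{a,b,c\}$ with $\tau(a)=aabaa$, $\tau(b)=abcab$, $\tau(c)=aabac$. Then $\tau$ is minimal, the words of length $3$ in $\mathcal L_\tau$ are exactly $$aab,\ aba,\ baa,\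 aaa,\ abc,\ bca,\ cab,\ bac,\ aca,\ caa,$$ $(X^{\mathbb N}_\tau,\sigma)$ is quasi-invertible, $\tau$ has exactly one fixed point $u\in\{a,b,c\}^{\mathbb N}$, it begins with $a$ and lies in $X^{\mathbb N}_\tau$, and it is a $3$-branch point of $(X^{\mathbb N}_\tau,\sigma)$ (hence its only branch point). Let $\phi$ be any map from these words to $\{\alpha,\beta,\gamma,d,e,f,g,h\}$ with $\phi(aaa)=\phi(baa)=\phi(aca)=\alpha$, $\phi(aba)=\beta$, $\phi(caa)=\gamma$, which maps the remaining words $aab,abc,bca,cab,bac$ bijectively to $\{d,e,f,g,h\}$. Put $\Phi(x)_n=\phi(x_{n-1}x_nx_{n+1})$ for $x\in X^{\mathbb Z}_\tau$ and $\Phi(x)_n=\phi(x_nx_{n+1}x_{n+2})$ for $x\in X^{\mathbb N}_\tau$. Then: 1. $\Phi$ is injective on $X^{\mathbb Z}_\tau$. 2. There is a minimal substitution $\tau'$ on $\{\alpha,\beta,\gamma,d,e,f,g,h\}$ with $\Phi(X^{\mathbb Z}_\tau)=X^{\mathbb Z}_{\tau'}$. 3. For every minimal substitution $\tau'$ on $\{\alpha,\beta,\gamma,d,e,f,g,h\}$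 with $\Phi(X^{\mathbb Z}_\tau)=X^{\mathbb Z}_{\tau'}$: the two-sided subshifts $(X^{\mathbb Z}_\tau,\sigma)$ and $(X^{\mathbb Z}_{\tau'},\sigma)$ are conjugate; the one-sided subshift $(X^{\mathbb N}_{\tau'},\sigma)$ has exactly two branch points, namely $\Phi(u)$ and $\alpha\Phi(u)$, which are distinct and both $2$-branch points; and the one-sided subshifts $(X^{\mathbb N}_\tau,\sigma)$ and $(X^{\mathbb N}_{\tau'},\sigma)$ are not conjugate. -/

import Mathlib

/-- The shift map on sequences indexed by `M` (used for `M = ℕ` and `M = ℤ`):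
`(σ x) m = x (m + 1)`. -/
def shift {M A : Type*} [Add M] [One M] (x : M → A) : M → A := fun m => x (m + 1)

/-- The word of length `k` that occurs in `x` at position `m`. -/
def wordAt {M A : Type*} [AddMonoidWithOne M] (x : M → A) (m : M) (k : ℕ) : List A :=
  (List.range k).map fun i : ℕ => x (m + (i : M))

/-- The language of a sequence: all words occurring in it. -/
def seqLang {M A : Type*} [AddMonoidWithOne M] (x : M → A) : Set (List A) :=
  {w | ∃ (m : M) (k : ℕ), w = wordAt x m k}

/-- The set of `M`-indexed sequences all of whose words belong to the language `L`. -/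
def subshiftOf (M : Type*) {A : Type*} [AddMonoidWithOne M] (L : Set (List A)) : Set (M → A) :=
  {x | seqLang x ⊆ L}

/-- A substitution on the alphabet `A`: each letter is sent to a nonempty word. -/
structure Substitution (A : Type*) where
  toFun : A → List A
  ne_nil : ∀ a, toFun a ≠ []

namespace Substitution

variable {A : Type*} (τ : Substitution A)

/-- The extension of a substitution to words, by concatenation. -/
def onWord (w : List A) : List A := w.flatMap τ.toFun

theorem length_le_onWord (w : List A) : w.length ≤ (τ.onWord w).length := by
  induction w with
  | nil => simp
  | cons a w ih =>
    have h : 0 < (τ.toFun a).length := List.length_pos_of_ne_nil (τ.ne_nil a)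
    simp only [onWord, List.flatMap_cons, List.length_append, List.length_cons] at *
    omega

/-- The extension of a substitution to one-sided sequences,
`τ(x) = τ(x 0) τ(x 1) τ(x 2) …`. As images of letters are nonempty, the letter at position `n`
can be read off from the word `τ(x 0) … τ(x n)`. -/
def onSeq (x : ℕ → A) : ℕ → A := fun n =>
  (τ.onWord (wordAt x 0 (n + 1)))[n]'(by
    have h := τ.length_le_onWord (wordAt x 0 (n + 1))
    have h' : (wordAt x 0 (n + 1)).length = n + 1 := by simp [wordAt]
    omega)

/-- The language generated by the words `τ ^ n (a)`, `n ≥ 1`: all their subwords. -/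
def lang : Set (List A) := {w | ∃ n : ℕ, 1 ≤ n ∧ ∃ a : A, w <:+: τ.onWord^[n] [a]}

/-- The `M`-indexed substitution subshift of `τ`, as a set of sequences
(one-sided for `M = ℕ`, two-sided for `M = ℤ`). -/
def subshift (M : Type*) [AddMonoidWithOne M] : Set (M → A) := subshiftOf M τ.lang

theorem shift_mem {M : Type*} [AddCommMonoidWithOne M] {x : M → A} (hx : x ∈ τ.subshift M) :
    shift x ∈ τ.subshift M := by
  rintro w ⟨m, k, rfl⟩
  refine hx ⟨m + 1, k, ?_⟩
  simp only [wordAt, shift]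
  refine List.map_congr_left fun i _ => ?_
  rw [add_right_comm]

/-- The shift map of the substitution subshift. -/
def sys (M : Type*) [AddCommMonoidWithOne M] : τ.subshift M → τ.subshift M :=
  fun x => ⟨shift x.1, τ.shift_mem x.2⟩

/-- `u` is a generating fixed point of `τ`: it is fixed by `τ`, its language is the language of
`τ`, and the words `τ ^ n (u 0)` become arbitrarily long. -/
def IsGeneratingFixedPoint (u : ℕ → A) : Prop :=
  τ.onSeq u = u ∧ τ.lang = seqLang u ∧
    Filter.Tendsto (fun n => (τ.onWord^[n] [u 0]).length) Filter.atTop Filter.atTop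

end Substitution

/-- A map is minimal if each forward orbit is dense. -/
def IsMinimalMap {Y : Type*} [TopologicalSpace Y] (T : Y → Y) : Prop :=
  ∀ y, Dense (Set.range fun n : ℕ => T^[n] y)

/-- `τ` is a minimal substitution: it has a generating fixed point, and its one-sided subshift
is minimal. -/
def Substitution.IsMinimal {A : Type*} [TopologicalSpace A] (τ : Substitution A) : Prop :=
  (∃ u, τ.IsGeneratingFixedPoint u) ∧ IsMinimalMap (τ.sys ℕ)

/-- `y` is a branch point of `(Y, T)`: it is not `T`-invertible, that is, it does not have exactly
one preimage. -/
def IsBranchPoint {Y : Type*} (T : Y → Y) (y : Y) : Prop := ¬ ∃! z, T z = y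

/-- `y` is a branch point of `(Y, T)` with exactly `k` preimages. -/
def IsKBranchPoint {Y : Type*} (k : ℕ) (T : Y → Y) (y : Y) : Prop :=
  IsBranchPoint T y ∧ (T ⁻¹' {y}).encard = k

/-- `(Y, T)` is quasi-invertible: it has exactly one branch point. -/
def IsQuasiInvertible {Y : Type*} (T : Y → Y) : Prop := ∃! y, IsBranchPoint T y

/-- Topological conjugacy of two systems. -/
def AreConjugate {X Y : Type*} [TopologicalSpace X] [TopologicalSpace Y]
    (S : X → X) (T : Y → Y) : Prop :=
  ∃ e : X ≃ₜ Y, Function.Semiconj e S T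

/-- The sliding block code with left and right radius one on two-sided sequences. -/
def blockCodeTwoSided {A B : Type*} (φ : A → A → A → B) (x : ℤ → A) : ℤ → B :=
  fun n => φ (x (n - 1)) (x n) (x (n + 1))

/-- The associated code on one-sided sequences: `φ(x 0 x 1 x 2) φ(x 1 x 2 x 3) …`. -/
def blockCodeOneSided {A B : Type*} (φ : A → A → A → B) (x : ℕ → A) : ℕ → B :=
  fun n => φ (x n) (x (n + 1)) (x (n + 2))

/-- The one-sided sequence `b y` that begins with the letter `b`, followed by `y`. -/
def consSeq {B : Type*} (b : B) (y : ℕ → B) : ℕ → B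
  | 0 => b
  | n + 1 => y n

/-- The three-letter alphabet. -/
inductive Letter
  | a | b | c

/-- The eight-letter alphabet. -/
inductive Symb
  | α | β | γ | d | e | f | g | h

instance : TopologicalSpace Letter := ⊥

instance : DiscreteTopology Letter := ⟨rfl⟩

instance : TopologicalSpace Symb := ⊥

instance : DiscreteTopology Symb := ⟨rfl⟩

open Letter in
/-- The substitution `a ↦ aabaa`, `b ↦ abcab`, `c ↦ aabac`. -/
def tau : Substitution Letter where
  toFun
    | a => [a, a, b, a, a]
    | b => [a, b, c, a, b]
    | c => [a, a, b, a, c]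
  ne_nil x := by cases x <;> simp

/-- The conditions on the local rule: `aaa`, `baa`, `aca` are sent to `α`, `aba` to `β`, `caa` to
`γ`, and the words `aab`, `abc`, `bca`, `cab`, `bac` are sent bijectively to `d, e, f, g, h`.
(No condition is made on triples that are not words of the subshift.) -/
structure IsLocalRule (φ : Letter → Letter → Letter → Symb) : Prop where
  aaa : φ .a .a .a = .α
  baa : φ .b .a .a = .α
  aca : φ .a .c .a = .α
  aba : φ .a .b .a = .β
  caa : φ .c .a .a = .γ
  rest : Set.BijOn (fun t : Letter × Letter × Letter => φ t.1 t.2.1 t.2.2)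
    {(.a, .a, .b), (.a, .b, .c), (.b, .c, .a), (.c, .a, .b), (.b, .a, .c)}
    {.d, .e, .f, .g, .h}

/-! Write u for `tauFix`. Each block `tau x` ends in x, has `a` at offsets 0 and 3, and never has
`a` at offset 2. So a sequence can be cut into blocks in one way only (`phase_unique`), and the last
letters of the blocks spell the desubstituted sequence. If a sequence has two left extensions by
distinct letters, it is therefore the image of a sequence with the same two extensions
(`exists_two_extensions_desubstitution`); iterating this forces it to be u. As au, bu and cu all lie
in the subshift, u is the only branch point and has three preimages.

The code merges only aaa, baa and aca, and two overlapping merged triples share the letters aa.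
Hence two consecutive symbols determine the letters common to their triples
(`IsLocalRule.overlap_eq`), so the two-sided code is injective. On one-sided sequences the first
letter can be lost: Φ(au) = Φ(bu) = αΦ(u), while Φ(cu) = γΦ(u). The triple branching at u thus
splits in two: Φ(u) keeps two preimages, and αΦ(u) acquires two, coming from aau and abu. Nothing
else branches (`IsLocalRule.branchPoint_cases`), and conjugacies preserve branch points.

A generating substitution for the image exists because a symbol still determines the last letter of
its triple, and the word `tau (tau x)` is always followed by aa: coding `tau (tau x) aa` gives the
image of a symbol (`codeSubstitution_lang`). -/

/-! ### Words, languages and the shift. -/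

theorem length_wordAt {M A : Type*} [AddMonoidWithOne M] (x : M → A) (m : M) (k : ℕ) :
    (wordAt x m k).length = k := by
  simp [wordAt]

theorem wordAt_eq_iff {M N A : Type*} [AddMonoidWithOne M] [AddMonoidWithOne N] {x : M → A}
    {y : N → A} {m : M} {n : N} {k : ℕ} :
    wordAt x m k = wordAt y n k ↔ ∀ i < k, x (m + (i : M)) = y (n + (i : N)) := by
  simp [wordAt, List.map_inj_left]

theorem wordAt_add {A : Type*} (x : ℕ → A) (m k l : ℕ) :
    wordAt x m (k + l) = wordAt x m k ++ wordAt x (m + k) l := by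
  simp [wordAt, List.range_add, add_assoc, Function.comp_def]

theorem wordAt_infix {A : Type*} (x : ℕ → A) {m k m' k' : ℕ} (h : m' ≤ m)
    (h' : m + k ≤ m' + k') : wordAt x m k <:+: wordAt x m' k' := by
  obtain ⟨p, rfl⟩ := Nat.exists_eq_add_of_le h
  obtain ⟨q, hq⟩ := Nat.exists_eq_add_of_le h'
  obtain rfl : k' = p + k + q := by omega
  exact ⟨wordAt x m' p, wordAt x (m' + p + k) q, by simp [wordAt_add, add_assoc]⟩

theorem exists_wordAt_of_infix {A : Type*} {x : ℕ → A} {m k : ℕ} {w : List A}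
    (h : w <:+: wordAt x m k) :
    ∃ j, j + w.length ≤ k ∧ w = wordAt x (m + j) w.length := by
  obtain ⟨s, t, e⟩ := h
  have hk : k = s.length + w.length + t.length := by
    have := congrArg List.length e
    simp [length_wordAt] at this
    omega
  subst hk
  rw [wordAt_add, wordAt_add] at e
  have e1 := (List.append_inj e (by simp [length_wordAt])).1
  exact ⟨s.length, by omega, (List.append_inj e1 (by simp [length_wordAt])).2⟩

theorem mem_subshiftOf_seqLang_iff {M N A : Type*} [AddMonoidWithOne M] [AddMonoidWithOne N]
    {u : N → A} {x : M → A} : x ∈ subshiftOf M (seqLang u) ↔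
      ∀ (m : M) (k : ℕ), ∃ n : N, ∀ i < k, x (m + (i : M)) = u (n + (i : N)) := by
  constructor
  · intro h m k
    obtain ⟨n, k', e⟩ := h ⟨m, k, rfl⟩
    obtain rfl : k = k' := by simpa [length_wordAt] using congrArg List.length e
    exact ⟨n, wordAt_eq_iff.1 e⟩
  · rintro h w ⟨m, k, rfl⟩
    obtain ⟨n, hn⟩ := h m k
    exact ⟨n, k, wordAt_eq_iff.2 hn⟩

theorem isClosed_subshiftOf (M : Type*) {A : Type*} [AddMonoidWithOne M] [TopologicalSpace A]
    [DiscreteTopology A] (L : Set (List A)) : IsClosed (subshiftOf M L) := by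
  have : subshiftOf M L = ⋂ (m : M) (k : ℕ),
      (fun (x : M → A) (i : Fin k) => x (m + ((i : ℕ) : M))) ⁻¹' {f | List.ofFn f ∈ L} := by
    ext x
    have e : ∀ m k, List.ofFn (fun i : Fin k => x (m + ((i : ℕ) : M))) = wordAt x m k := by
      intro m k
      refine List.ext_getElem (by simp [wordAt]) ?_
      simp [wordAt]
    simp only [Set.mem_iInter, Set.mem_preimage, Set.mem_ofPred_eq, e]
    exact ⟨fun h m k => h ⟨m, k, rfl⟩, by rintro h w ⟨m, k, rfl⟩; exact h m k⟩
  rw [this]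
  exact isClosed_iInter fun m => isClosed_iInter fun k =>
    (isClosed_discrete _).preimage (by fun_prop)

theorem continuous_shift {M A : Type*} [Add M] [One M] [TopologicalSpace A] :
    Continuous (shift : (M → A) → M → A) := by
  unfold shift; fun_prop

theorem iterate_shift {A : Type*} (n : ℕ) (x : ℕ → A) (i : ℕ) : shift^[n] x i = x (i + n) := by
  induction n generalizing x with
  | zero => rfl
  | succ n ih => rw [Function.iterate_succ_apply, ih]; simp [shift, add_assoc]

/-! ### Primitive substitutions of constant length. -/

namespace Substitution

variable {A : Type*} (θ : Substitution A)

theorem onWord_append (v w : List A) : θ.onWord (v ++ w) = θ.onWord v ++ θ.onWord w := by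
  simp [onWord]

theorem onWord_singleton (a : A) : θ.onWord [a] = θ.toFun a := by
  simp [onWord]

theorem onWord_infix {v w : List A} (h : v <:+: w) : θ.onWord v <:+: θ.onWord w := by
  obtain ⟨s, t, rfl⟩ := h
  exact ⟨θ.onWord s, θ.onWord t, by simp [onWord_append]⟩

theorem iterate_onWord_infix {v w : List A} (h : v <:+: w) (n : ℕ) :
    θ.onWord^[n] v <:+: θ.onWord^[n] w := by
  induction n with
  | zero => exact h
  | succ n ih => simpa only [Function.iterate_succ_apply'] using θ.onWord_infix ih

section ConstantLength

variable {θ} {L : ℕ} (hL : ∀ a, (θ.toFun a).length = L)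
include hL

theorem length_onWord (w : List A) : (θ.onWord w).length = L * w.length := by
  induction w with
  | nil => simp [onWord]
  | cons a w ih =>
    have : θ.onWord (a :: w) = θ.toFun a ++ θ.onWord w := by simp [onWord]
    rw [this, List.length_append, hL, ih, List.length_cons]; ring

theorem onSeq_spec (hL0 : 0 < L) (x : ℕ → A) (n : ℕ) :
    (θ.toFun (x (n / L)))[n % L]? = some (θ.onSeq x n) := by
  have e : θ.onWord (wordAt x 0 (n + 1)) = θ.onWord (wordAt x 0 (n / L)) ++
      (θ.toFun (x (n / L)) ++ θ.onWord (wordAt x (n / L + 1) (n - n / L))) := by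
    have h : n + 1 = n / L + (1 + (n - n / L)) := by have := Nat.div_le_self n L; omega
    have h1 : wordAt x (n / L) 1 = [x (n / L)] := by simp [wordAt]
    conv_lhs => rw [h]
    rw [wordAt_add, wordAt_add, onWord_append, onWord_append, zero_add, h1, onWord_singleton]
  have h1 : (θ.onWord (wordAt x 0 (n / L))).length = L * (n / L) := by
    rw [length_onWord hL, length_wordAt]
  have h2 := Nat.div_add_mod n L
  have h3 := Nat.mod_lt n hL0
  have h4 : some (θ.onSeq x n) = (θ.onWord (wordAt x 0 (n + 1)))[n]? := by
    unfold onSeq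
    exact (List.getElem?_eq_getElem _).symm
  rw [h4, e, List.getElem?_append_right (by omega), h1,
    List.getElem?_append_left (by rw [hL]; omega)]
  congr 1
  omega

theorem toFun_eq_wordAt (x : ℕ → A) (q : ℕ) :
    θ.toFun (x q) = wordAt (θ.onSeq x) (L * q) L := by
  refine List.ext_getElem? fun i => ?_
  by_cases hi : i < L
  · have h := onSeq_spec hL (by omega) x (L * q + i)
    rw [Nat.mul_add_div (by omega), Nat.mul_add_mod, Nat.div_eq_of_lt hi, Nat.mod_eq_of_lt hi,
      add_zero] at h
    simp [h, wordAt, hi]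
  · rw [List.getElem?_eq_none (by rw [hL]; omega),
      List.getElem?_eq_none (by rw [length_wordAt]; omega)]

theorem onWord_wordAt (x : ℕ → A) (m k : ℕ) :
    θ.onWord (wordAt x m k) = wordAt (θ.onSeq x) (L * m) (L * k) := by
  induction k with
  | zero => simp [wordAt, onWord]
  | succ k ih =>
    have h1 : wordAt x (m + k) 1 = [x (m + k)] := by simp [wordAt]
    rw [wordAt_add, onWord_append, ih, h1, onWord_singleton, toFun_eq_wordAt hL, mul_add, mul_add,
      mul_one, wordAt_add]

theorem eq_onSeq_iff (hL0 : 0 < L) {x y : ℕ → A} :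
    θ.onSeq x = y ↔ ∀ n, (θ.toFun (x (n / L)))[n % L]? = some (y n) := by
  constructor
  · rintro rfl n
    exact onSeq_spec hL hL0 x n
  · intro h
    funext n
    have := h n
    rw [onSeq_spec hL hL0] at this
    exact Option.some_injective _ this

theorem iterate_onWord_wordAt {v : ℕ → A} (hv : θ.onSeq v = v) (n m k : ℕ) :
    θ.onWord^[n] (wordAt v m k) = wordAt v (L ^ n * m) (L ^ n * k) := by
  induction n with
  | zero => simp
  | succ n ih => rw [Function.iterate_succ_apply', ih, onWord_wordAt hL, hv, pow_succ']; ring_nf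

theorem iterate_onWord_singleton {v : ℕ → A} (hv : θ.onSeq v = v) (n m : ℕ) :
    θ.onWord^[n] [v m] = wordAt v (L ^ n * m) (L ^ n) := by
  have := iterate_onWord_wordAt hL hv n m 1
  rwa [mul_one, show wordAt v m 1 = [v m] by simp [wordAt]] at this

theorem lang_eq_seqLang (h2 : 2 ≤ L) {v : ℕ → A} (hv : θ.onSeq v = v)
    (hsurj : Function.Surjective v) : θ.lang = seqLang v := by
  ext w
  constructor
  · rintro ⟨n, -, a, h⟩
    obtain ⟨m, rfl⟩ := hsurj a
    rw [iterate_onWord_singleton hL hv] at h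
    obtain ⟨j, -, hj⟩ := exists_wordAt_of_infix h
    exact ⟨_, _, hj⟩
  · rintro ⟨m, k, rfl⟩
    refine ⟨m + k + 1, by omega, v 0, ?_⟩
    rw [iterate_onWord_singleton hL hv]
    refine wordAt_infix v (by simp) ?_
    have : m + k + 1 < L ^ (m + k + 1) := Nat.lt_pow_self (by omega)
    omega

theorem surjective_of_primitive {v : ℕ → A} (hv : θ.onSeq v = v)
    (hprim : ∀ s t, t ∈ θ.onWord^[2] [s]) : Function.Surjective v := by
  intro t
  have h := hprim (v 0) t
  rw [iterate_onWord_singleton hL hv] at h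
  simp only [wordAt, List.mem_map] at h
  obtain ⟨i, -, h⟩ := h
  exact ⟨_, h⟩

theorem exists_infix_of_mem_lang (h2 : 2 ≤ L) {v : ℕ → A} (hv : θ.onSeq v = v)
    (hprim : ∀ s t, t ∈ θ.onWord^[2] [s]) {w : List A} (hw : w ∈ θ.lang) :
    ∃ K, ∀ m, w <:+: wordAt v m K := by
  obtain ⟨n, -, t, h⟩ := hw
  -- Two extra iterations put t, hence w, in every aligned block of length N = L ^ (n + 2); any
  -- window of length 2 * N contains a whole such block.
  refine ⟨2 * L ^ (n + 2), fun m => h.trans ?_⟩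
  set N := L ^ (n + 2) with hN
  have hN0 : 0 < N := by positivity
  have h1 : wordAt v (N * (m / N + 1)) N <:+: wordAt v m (2 * N) := by
    have := Nat.div_add_mod m N
    have := Nat.mod_lt m hN0
    refine wordAt_infix v ?_ ?_ <;> rw [mul_add, mul_one] <;> omega
  refine List.IsInfix.trans ?_ h1
  rw [hN, ← iterate_onWord_singleton hL hv, Function.iterate_add_apply]
  refine θ.iterate_onWord_infix ?_ n
  obtain ⟨s, r, e⟩ := List.append_of_mem (hprim (v (m / L ^ (n + 2) + 1)) t)
  exact ⟨s, r, by rw [e]; simp⟩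

/-- Uniform recurrence gives minimality: a long enough prefix of y is a window of v, so it contains
the prefix of z that determines a basic neighbourhood. -/
theorem isMinimal_of_primitive [TopologicalSpace A] [DiscreteTopology A] (h2 : 2 ≤ L) {v : ℕ → A}
    (hv : θ.onSeq v = v) (hprim : ∀ s t, t ∈ θ.onWord^[2] [s]) : θ.IsMinimal := by
  have hlang := lang_eq_seqLang hL h2 hv (surjective_of_primitive hL hv hprim)
  refine ⟨⟨v, hv, hlang, ?_⟩, ?_⟩
  · simp only [iterate_onWord_singleton hL hv, length_wordAt]
    exact tendsto_pow_atTop_atTop_of_one_lt (by omega)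
  · intro y z
    rw [mem_closure_iff]
    intro o ho hz
    obtain ⟨o', ho', rfl⟩ := isOpen_induced_iff.1 ho
    obtain ⟨I, c, hI, hsub⟩ := isOpen_pi_iff.1 ho' z.1 hz
    set k := I.sup id + 1
    have hw : wordAt z.1 0 k ∈ θ.lang := z.2 ⟨0, k, rfl⟩
    obtain ⟨K, hK⟩ := exists_infix_of_mem_lang hL h2 hv hprim hw
    have hy : wordAt y.1 0 K ∈ θ.lang := y.2 ⟨0, K, rfl⟩
    rw [hlang] at hy
    obtain ⟨m, K', e⟩ := hy
    obtain rfl : K = K' := by simpa [length_wordAt] using congrArg List.length e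
    have h := hK m
    rw [← e] at h
    obtain ⟨j, -, hj⟩ := exists_wordAt_of_infix h
    rw [length_wordAt, wordAt_eq_iff] at hj
    refine ⟨(θ.sys ℕ)^[j] y, hsub ?_, j, rfl⟩
    have hval : ∀ n : ℕ, ((θ.sys ℕ)^[n] y).1 = shift^[n] y.1 := by
      intro n
      induction n with
      | zero => rfl
      | succ n ih => rw [Function.iterate_succ_apply', Function.iterate_succ_apply', ← ih]; rfl
    intro i hi
    have hik : i < k := Nat.lt_succ_of_le (Finset.le_sup (f := id) hi)
    have := hj i hik
    simp only [zero_add, Nat.cast_id] at this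
    rw [hval, iterate_shift, add_comm i j, ← this]
    exact (hI i hi).2

end ConstantLength

/-- The fixed point with first letter `s` of a substitution of constant length `L ≥ 2`. -/
def fixedSeq (L : ℕ) (s : A) : ℕ → A
  | 0 => s
  | n + 1 => if _h : (n + 1) / L < n + 1 then
      (θ.toFun (fixedSeq L s ((n + 1) / L))).getD ((n + 1) % L) s else s

theorem onSeq_fixedSeq {L : ℕ} (hL : ∀ a, (θ.toFun a).length = L) (h2 : 2 ≤ L) {s : A}
    (hs : (θ.toFun s)[0]? = some s) : θ.onSeq (θ.fixedSeq L s) = θ.fixedSeq L s := by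
  rw [eq_onSeq_iff hL (by omega)]
  intro n
  cases n with
  | zero => simpa [fixedSeq] using hs
  | succ n =>
    have h : (n + 1) / L < n + 1 := Nat.div_lt_self (by omega) (by omega)
    have h' : (n + 1) % L < L := Nat.mod_lt _ (by omega)
    rw [fixedSeq.eq_2, dif_pos h, List.getD_eq_getElem _ _ (by rwa [hL]),
      List.getElem?_eq_getElem]

/-! ### Compactness, surjectivity of the shift, two-sided extensions. -/

variable [TopologicalSpace A] [DiscreteTopology A] [Finite A]

instance (M : Type*) [AddMonoidWithOne M] : CompactSpace (θ.subshift M) :=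
  isCompact_iff_compactSpace.1 (isClosed_subshiftOf M θ.lang).isCompact

variable {θ}

/-- The range is compact, hence closed, and it contains the forward orbit of an image point, which
is dense. -/
theorem surjective_of_isMinimalMap (h : IsMinimalMap (θ.sys ℕ)) :
    Function.Surjective (θ.sys ℕ) := by
  have hc : Continuous (θ.sys ℕ) :=
    (continuous_shift.comp continuous_subtype_val).subtype_mk _
  rintro y
  have hd : Dense (Set.range (θ.sys ℕ)) := (h (θ.sys ℕ y)).mono (by
    rintro _ ⟨n, rfl⟩
    exact ⟨(θ.sys ℕ)^[n] y, by
      simp only [← Function.iterate_succ_apply, Function.iterate_succ_apply']⟩)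
  have hcl := (isCompact_range hc).isClosed
  have : Set.range (θ.sys ℕ) = Set.univ := by rw [← hcl.closure_eq, hd.closure_eq]
  exact Set.range_eq_univ.1 this y

omit [TopologicalSpace A] [DiscreteTopology A] [Finite A] in
theorem restrict_mem {x : ℤ → A} (hx : x ∈ θ.subshift ℤ) (m : ℤ) :
    (fun n : ℕ => x (m + n)) ∈ θ.subshift ℕ := by
  rintro w ⟨n, k, rfl⟩
  refine hx ⟨m + n, k, ?_⟩
  simp [wordAt, add_assoc]

omit [DiscreteTopology A] [Finite A] [TopologicalSpace A] in
theorem exists_extension_of_surjective (h : Function.Surjective (θ.sys ℕ)) {x : ℕ → A}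
    (hx : x ∈ θ.subshift ℕ) : ∃ X ∈ θ.subshift ℤ, ∀ n : ℕ, X n = x n := by
  choose g hg using h
  set y : ℕ → θ.subshift ℕ := fun n => g^[n] ⟨x, hx⟩ with hy
  have hstep : ∀ n i, (y (n + 1)).1 (i + 1) = (y n).1 i := by
    intro n i
    have : θ.sys ℕ (y (n + 1)) = y n := by rw [hy]; simp only [Function.iterate_succ_apply', hg]
    rw [← this]; rfl
  have hsteps : ∀ k n i, (y (n + k)).1 (i + k) = (y n).1 i := by
    intro k
    induction k with
    | zero => intros; rfl
    | succ k ih => intro n i; rw [← add_assoc, ← add_assoc, hstep, ih]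
  -- `y n` is x with n letters added on the left, so `z.natAbs` of them suffice to reach position z;
  -- `hXy` says that any larger number gives the same letter.
  set X : ℤ → A := fun z => (y z.natAbs).1 (z + z.natAbs).toNat with hX
  have hXy : ∀ (z : ℤ) (n i : ℕ), z + n = i → X z = (y n).1 i := by
    intro z n i e
    rcases le_total z.natAbs n with hle | hle
    · obtain ⟨k, rfl⟩ := Nat.exists_eq_add_of_le hle
      have : i = (z + z.natAbs).toNat + k := by omega
      rw [this, hsteps]
    · obtain ⟨k, hk⟩ := Nat.exists_eq_add_of_le hle
      have : (z + z.natAbs).toNat = i + k := by omega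
      simp only [hX]
      rw [this, hk, hsteps]
  refine ⟨X, ?_, fun n => hXy n 0 n (by simp)⟩
  rintro w ⟨m, k, rfl⟩
  refine (y m.natAbs).2 ⟨(m + m.natAbs).toNat, k, ?_⟩
  rw [wordAt_eq_iff]
  intro i _
  refine hXy _ _ _ ?_
  simp only [Nat.cast_id]
  omega

end Substitution

/-! ### The substitution `tau`, its fixed point and its words of length three. -/

instance : DecidableEq Letter := fun x y => by
  cases x <;> cases y <;> first | exact isTrue rfl | exact isFalse (by simp)

instance : Fintype Letter := ⟨{.a, .b, .c}, fun x => by cases x <;> simp⟩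

theorem length_tau (x : Letter) : (tau.toFun x).length = 5 := by cases x <;> rfl

/-- The letter at position `r < 5` of `tau x`. -/
def tauLetter (x : Letter) (r : ℕ) : Letter := (tau.toFun x).getD r .a

theorem tauLetter_zero (x : Letter) : tauLetter x 0 = .a := by cases x <;> rfl

theorem tauLetter_two (x : Letter) : tauLetter x 2 ≠ .a := by cases x <;> decide

theorem tauLetter_three (x : Letter) : tauLetter x 3 = .a := by cases x <;> rfl

theorem tauLetter_four (x : Letter) : tauLetter x 4 = x := by cases x <;> rfl

theorem onSeq_tau_eq_iff {x y : ℕ → Letter} :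
    tau.onSeq x = y ↔ ∀ n, y n = tauLetter (x (n / 5)) (n % 5) := by
  rw [Substitution.eq_onSeq_iff length_tau (by omega)]
  refine forall_congr' fun n => ?_
  have h : n % 5 < (tau.toFun (x (n / 5))).length := by rw [length_tau]; omega
  rw [tauLetter, List.getD_eq_getElem _ _ h, List.getElem?_eq_getElem h, Option.some_inj, eq_comm]

/-- The fixed point of `tau`. -/
def tauFix : ℕ → Letter := tau.fixedSeq 5 .a

theorem tauFix_zero : tauFix 0 = .a := by
  rw [tauFix, Substitution.fixedSeq]

theorem onSeq_tauFix : tau.onSeq tauFix = tauFix :=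
  tau.onSeq_fixedSeq length_tau (by omega) rfl

theorem tauFix_eq (n : ℕ) : tauFix n = tauLetter (tauFix (n / 5)) (n % 5) :=
  onSeq_tau_eq_iff.1 onSeq_tauFix n

theorem tauFix_mul_add (q : ℕ) {r : ℕ} (hr : r < 5) :
    tauFix (5 * q + r) = tauLetter (tauFix q) r := by
  rw [tauFix_eq]
  congr 2 <;> omega

theorem tauFix_one : tauFix 1 = .a := by
  rw [tauFix_eq]; norm_num [tauFix_zero]; rfl

theorem tauFix_two : tauFix 2 = .b := by
  rw [tauFix_eq]; norm_num [tauFix_zero]; rfl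

theorem tau_primitive (s t : Letter) : t ∈ tau.onWord^[2] [s] := by
  cases s <;> cases t <;> decide

theorem tau_lang : tau.lang = seqLang tauFix :=
  Substitution.lang_eq_seqLang length_tau (by omega) onSeq_tauFix
    (Substitution.surjective_of_primitive length_tau onSeq_tauFix tau_primitive)

theorem tau_isMinimal : tau.IsMinimal :=
  Substitution.isMinimal_of_primitive length_tau (by omega) onSeq_tauFix tau_primitive

theorem mem_tau_subshift_iff {M : Type*} [AddMonoidWithOne M] {x : M → Letter} :
    x ∈ tau.subshift M ↔
      ∀ (m : M) (k : ℕ), ∃ n : ℕ, ∀ i < k, x (m + (i : M)) = tauFix (n + i) := by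
  rw [Substitution.subshift, tau_lang]
  exact mem_subshiftOf_seqLang_iff

theorem tauFix_mem : tauFix ∈ tau.subshift ℕ :=
  mem_tau_subshift_iff.2 fun m _ => ⟨m, fun _ _ => rfl⟩

theorem sys_tau_surjective : Function.Surjective (tau.sys ℕ) :=
  Substitution.surjective_of_isMinimalMap tau_isMinimal.2

/-- The words of length three of the language of `tau`. -/
def tripleWords : List (Letter × Letter × Letter) :=
  [(.a, .a, .b), (.a, .b, .a), (.b, .a, .a), (.a, .a, .a), (.a, .b, .c), (.b, .c, .a),
    (.c, .a, .b), (.b, .a, .c), (.a, .c, .a), (.c, .a, .a)]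

/-- The word bb has to be excluded because its image would contain bab across the block boundary. -/
theorem tauFix_pair (m : ℕ) : ¬ (tauFix m = .b ∧ tauFix (m + 1) = .b) := by
  obtain ⟨q, r, hr, rfl⟩ : ∃ q r, r < 5 ∧ m = 5 * q + r := ⟨m / 5, m % 5, by omega, by omega⟩
  rw [tauFix_mul_add q hr]
  rcases (by omega : r < 4 ∨ r = 4) with h | rfl
  · rw [add_assoc, tauFix_mul_add q (by omega)]
    generalize tauFix q = x
    interval_cases r <;> cases x <;> decide
  · have : 5 * q + 4 + 1 = 5 * (q + 1) + 0 := by ring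
    rw [this, tauFix_mul_add _ (by omega), tauLetter_zero]
    simp

theorem tauFix_triple (m : ℕ) :
    (tauFix m, tauFix (m + 1), tauFix (m + 2)) ∈ tripleWords := by
  obtain ⟨q, r, hr, rfl⟩ : ∃ q r, r < 5 ∧ m = 5 * q + r := ⟨m / 5, m % 5, by omega, by omega⟩
  rcases (by omega : r < 3 ∨ r = 3 ∨ r = 4) with h | rfl | rfl
  · rw [add_assoc, add_assoc, tauFix_mul_add q hr, tauFix_mul_add q (by omega),
      tauFix_mul_add q (by omega)]
    generalize tauFix q = x
    interval_cases r <;> cases x <;> decide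
  · have : 5 * q + 3 + 2 = 5 * (q + 1) + 0 := by ring
    rw [this, add_assoc, tauFix_mul_add q hr, tauFix_mul_add q (by omega),
      tauFix_mul_add _ (by omega)]
    generalize tauFix q = x
    generalize tauFix (q + 1) = y
    cases x <;> cases y <;> decide
  · have h1 : 5 * q + 4 + 1 = 5 * (q + 1) + 0 := by ring
    have h2 : 5 * q + 4 + 2 = 5 * (q + 1) + 1 := by ring
    rw [h1, h2, tauFix_mul_add q hr, tauFix_mul_add _ (by omega), tauFix_mul_add _ (by omega)]
    have h3 := tauFix_pair q
    revert h3
    generalize tauFix q = x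
    generalize tauFix (q + 1) = y
    cases x <;> cases y <;> decide

theorem triple_mem {M : Type*} [AddMonoidWithOne M] {x : M → Letter} (hx : x ∈ tau.subshift M)
    (m : M) : (x m, x (m + 1), x (m + 2)) ∈ tripleWords := by
  obtain ⟨n, h⟩ := mem_tau_subshift_iff.1 hx m 3
  have h0 := h 0 (by omega)
  have h1 := h 1 (by omega)
  have h2 := h 2 (by omega)
  simp only [Nat.cast_zero, add_zero, Nat.cast_one, Nat.cast_ofNat] at h0 h1 h2
  rw [h0, h1, h2]
  exact tauFix_triple n

theorem exists_tauFix_triple {x y z : Letter} (h : (x, y, z) ∈ tripleWords) :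
    ∃ n, tauFix n = x ∧ tauFix (n + 1) = y ∧ tauFix (n + 2) = z := by
  -- The single word `tau (tau b)` contains all ten triples.
  have hw : [x, y, z] <:+: tau.onWord^[2] [.b] := by revert x y z; decide
  have : [x, y, z] ∈ tau.lang := ⟨2, by omega, _, hw⟩
  rw [tau_lang] at this
  obtain ⟨n, k, e⟩ := this
  obtain rfl : 3 = k := by simpa [length_wordAt] using congrArg List.length e
  refine ⟨n, ?_⟩
  simp [wordAt, List.range_succ] at e
  simp [e]

theorem tau_lang_three : {w | w ∈ tau.lang ∧ w.length = 3} =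
    ({[.a, .a, .b], [.a, .b, .a], [.b, .a, .a], [.a, .a, .a], [.a, .b, .c], [.b, .c, .a],
      [.c, .a, .b], [.b, .a, .c], [.a, .c, .a], [.c, .a, .a]} : Set (List Letter)) := by
  have h : {w | w ∈ tau.lang ∧ w.length = 3} =
      {w | ∃ t ∈ tripleWords, w = [t.1, t.2.1, t.2.2]} := by
    ext w
    rw [tau_lang]
    constructor
    · rintro ⟨⟨m, k, rfl⟩, hk⟩
      rw [length_wordAt] at hk
      subst hk
      exact ⟨_, tauFix_triple m, by simp [wordAt, List.range_succ]⟩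
    · rintro ⟨⟨x, y, z⟩, ht, rfl⟩
      obtain ⟨n, rfl, rfl, rfl⟩ := exists_tauFix_triple ht
      exact ⟨⟨n, 3, by simp [wordAt, List.range_succ]⟩, rfl⟩
  rw [h]
  ext w
  simp [tripleWords]

/-! ### Recognizability and the unique branch point. -/

theorem exists_desubstitution {x : ℕ → Letter} (hx : x ∈ tau.subshift ℕ) :
    ∃ p < 5, ∃ y ∈ tau.subshift ℕ, ∀ i, x i = tauLetter (y ((p + i) / 5)) ((p + i) % 5) := by
  have h0 : ∀ k, ∃ n, ∀ i < k, x i = tauFix (n + i) := fun k => by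
    simpa using mem_tau_subshift_iff.1 hx 0 k
  -- Pigeonhole on phases: if each phase p failed for the prefix of length `k p`, the prefix of
  -- length the sum of all `k p` could occur in no phase.
  obtain ⟨p, hp, h⟩ : ∃ p < 5, ∀ k, ∃ q, ∀ i < k, x i = tauFix (5 * q + p + i) := by
    by_contra! hcon
    choose! k hk using hcon
    obtain ⟨n, hn⟩ := h0 (∑ p ∈ Finset.range 5, k p)
    obtain ⟨i, hi, hne⟩ := hk (n % 5) (by omega) (n / 5)
    refine hne ?_
    rw [hn i (hi.trans_le (Finset.single_le_sum (f := k) (fun _ _ => Nat.zero_le _)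
      (Finset.mem_range.2 (by omega)))), Nat.div_add_mod]
  have key : ∀ k, ∃ q, (∀ i < k, x i = tauLetter (tauFix (q + (p + i) / 5)) ((p + i) % 5)) ∧
      ∀ j < k, x (5 * j + 4 - p) = tauFix (q + j) := by
    intro k
    obtain ⟨q, hq⟩ := h (5 * k)
    refine ⟨q, fun i hi => ?_, fun j hj => ?_⟩
    · rw [hq i (by omega), tauFix_eq, show (5 * q + p + i) / 5 = q + (p + i) / 5 by omega,
        show (5 * q + p + i) % 5 = (p + i) % 5 by omega]
    · rw [hq _ (by omega), ← tauLetter_four (tauFix (q + j)), ← tauFix_mul_add _ (by omega)]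
      congr 1
      omega
  -- The last letter of a block is the letter substituted, so the desubstituted sequence is read off
  -- x itself and does not depend on the occurrence q.
  refine ⟨p, hp, fun j => x (5 * j + 4 - p), ?_, fun i => ?_⟩
  · refine mem_tau_subshift_iff.2 fun m k => ?_
    obtain ⟨q, -, hq⟩ := key (m + k)
    exact ⟨q + m, fun i hi => by rw [Nat.cast_id, hq _ (by omega), add_assoc]⟩
  · obtain ⟨q, hq, hq'⟩ := key (i + 6)
    have h5 : (p + i) / 5 < i + 6 := by omega
    rw [hq i (by omega), ← hq' _ h5]

/-- An offset-2 letter of one cutting is not `a`, so it cannot stand at offset 0 or 3 of the other.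
Used in both directions, this excludes every nonzero phase difference mod 5. -/
theorem phase_unique {x y y' : ℕ → Letter} {p p' : ℕ}
    (h : ∀ i, x i = tauLetter (y ((p + i) / 5)) ((p + i) % 5))
    (h' : ∀ i, x i = tauLetter (y' ((p' + i) / 5)) ((p' + i) % 5)) : p % 5 = p' % 5 := by
  have key : ∀ {y y' : ℕ → Letter} {p p' : ℕ},
      (∀ i, x i = tauLetter (y ((p + i) / 5)) ((p + i) % 5)) →
      (∀ i, x i = tauLetter (y' ((p' + i) / 5)) ((p' + i) % 5)) →
      (p' + (7 - p % 5)) % 5 ≠ 0 ∧ (p' + (7 - p % 5)) % 5 ≠ 3 := by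
    intro y y' p p' h h'
    -- An index at offset 2; the 7, congruent to 2 mod 5, keeps the subtraction from being
    -- truncated.
    have h1 := h (7 - p % 5)
    have h2 := h' (7 - p % 5)
    rw [show (p + (7 - p % 5)) % 5 = 2 by omega] at h1
    constructor <;> intro e <;> rw [e] at h2
    · rw [tauLetter_zero, h1] at h2
      exact tauLetter_two _ h2
    · rw [tauLetter_three, h1] at h2
      exact tauLetter_two _ h2
  have h1 := key h h'
  have h2 := key h' h
  omega

theorem eq_consSeq_shift {B : Type*} (y : ℕ → B) : y = consSeq (y 0) (shift y) := by
  funext n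
  cases n <;> rfl

theorem exists_two_extensions_desubstitution {x : ℕ → Letter} {l l' : Letter} (hne : l ≠ l')
    (h : consSeq l x ∈ tau.subshift ℕ) (h' : consSeq l' x ∈ tau.subshift ℕ) :
    ∃ y, consSeq l y ∈ tau.subshift ℕ ∧ consSeq l' y ∈ tau.subshift ℕ ∧ tau.onSeq y = x := by
  obtain ⟨p, hp, y, hy, e⟩ := exists_desubstitution h
  obtain ⟨p', hp', y', hy', e'⟩ := exists_desubstitution h'
  have ex : ∀ i, x i = tauLetter (y ((p + 1 + i) / 5)) ((p + 1 + i) % 5) := fun i => by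
    rw [add_assoc, add_comm 1 i]; exact e (i + 1)
  have ex' : ∀ i, x i = tauLetter (y' ((p' + 1 + i) / 5)) ((p' + 1 + i) % 5) := fun i => by
    rw [add_assoc, add_comm 1 i]; exact e' (i + 1)
  obtain rfl : p = p' := by have := phase_unique ex ex'; omega
  have e0 : l = tauLetter (y 0) p := by
    have := e 0
    rwa [add_zero, Nat.div_eq_of_lt hp, Nat.mod_eq_of_lt hp] at this
  have e0' : l' = tauLetter (y' 0) p := by
    have := e' 0
    rwa [add_zero, Nat.div_eq_of_lt hp, Nat.mod_eq_of_lt hp] at this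
  -- For p < 4 the last letter of the first block is still visible in x; it determines that block,
  -- which would give l = l'.
  rcases (by omega : p < 4 ∨ p = 4) with hp4 | rfl
  · have h1 := ex (3 - p)
    have h2 := ex' (3 - p)
    rw [show (p + 1 + (3 - p)) / 5 = 0 by omega, show (p + 1 + (3 - p)) % 5 = 4 by omega,
      tauLetter_four] at h1 h2
    exact absurd (by rw [e0, e0', ← h1, ← h2]) hne
  · rw [tauLetter_four] at e0 e0'
    have hy0 : ∀ j, y (j + 1) = x (5 * j + 4) := fun j => by
      rw [ex, show (4 + 1 + (5 * j + 4)) / 5 = j + 1 by omega,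
        show (4 + 1 + (5 * j + 4)) % 5 = 4 by omega, tauLetter_four]
    have hy0' : ∀ j, y' (j + 1) = x (5 * j + 4) := fun j => by
      rw [ex', show (4 + 1 + (5 * j + 4)) / 5 = j + 1 by omega,
        show (4 + 1 + (5 * j + 4)) % 5 = 4 by omega, tauLetter_four]
    refine ⟨shift y, ?_, ?_, ?_⟩
    · rwa [e0, ← eq_consSeq_shift]
    · have : shift y = shift y' := by funext j; exact (hy0 j).trans (hy0' j).symm
      rwa [e0', this, ← eq_consSeq_shift]
    · refine onSeq_tau_eq_iff.2 fun n => ?_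
      rw [ex n, shift, show (4 + 1 + n) / 5 = n / 5 + 1 by omega,
        show (4 + 1 + n) % 5 = n % 5 by omega]

/-- Strong induction works because letter i of x depends only on letter i / 5 of a desubstitution
that satisfies the same hypotheses, and letter 0 is always `a`. -/
theorem eq_tauFix_of_two_extensions {x : ℕ → Letter} {l l' : Letter} (hne : l ≠ l')
    (h : consSeq l x ∈ tau.subshift ℕ) (h' : consSeq l' x ∈ tau.subshift ℕ) : x = tauFix := by
  funext i
  induction i using Nat.strong_induction_on generalizing x with
  | _ i ih =>
    obtain ⟨y, hy, hy', e⟩ := exists_two_extensions_desubstitution hne h h'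
    rw [onSeq_tau_eq_iff.1 e i]
    rcases Nat.eq_zero_or_pos i with rfl | hi
    · rw [Nat.zero_mod, tauLetter_zero, tauFix_zero]
    · rw [ih (i / 5) (by omega) hy hy', ← tauFix_eq]

theorem onSeq_tau_eq_self_iff {x : ℕ → Letter} : tau.onSeq x = x ↔ x = tauFix := by
  refine ⟨fun h => ?_, by rintro rfl; exact onSeq_tauFix⟩
  funext i
  induction i using Nat.strong_induction_on with
  | _ i ih =>
    rw [onSeq_tau_eq_iff.1 h i]
    rcases Nat.eq_zero_or_pos i with rfl | hi
    · rw [Nat.zero_mod, tauLetter_zero, tauFix_zero]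
    · rw [ih (i / 5) (by omega), ← tauFix_eq]

/-- Start from an occurrence of l followed by `a`: its n-th image contains l followed by the prefix
of u of length 5 ^ n, since blocks end in the letter substituted. -/
theorem consSeq_tauFix_mem (l : Letter) : consSeq l tauFix ∈ tau.subshift ℕ := by
  obtain ⟨q, hq, hq'⟩ : ∃ q, tauFix q = l ∧ tauFix (q + 1) = .a := by
    have : ∃ z, (l, Letter.a, z) ∈ tripleWords := by cases l <;> decide
    obtain ⟨z, hz⟩ := this
    obtain ⟨q, h, h', -⟩ := exists_tauFix_triple hz
    exact ⟨q, h, h'⟩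
  have key : ∀ n, ∃ m, tauFix m = l ∧ ∀ i < 5 ^ n, tauFix (m + 1 + i) = tauFix i := by
    intro n
    induction n with
    | zero => exact ⟨q, hq, by simp [hq', tauFix_zero]⟩
    | succ n ih =>
      obtain ⟨m, hm, h⟩ := ih
      refine ⟨5 * m + 4, by rw [tauFix_mul_add _ (by omega), hm, tauLetter_four], fun i hi => ?_⟩
      rw [tauFix_eq, tauFix_eq i, ← h (i / 5) (by rw [pow_succ] at hi; omega),
        show (5 * m + 4 + 1 + i) / 5 = m + 1 + i / 5 by omega,
        show (5 * m + 4 + 1 + i) % 5 = i % 5 by omega]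
  refine mem_tau_subshift_iff.2 fun m k => ?_
  obtain ⟨n, hn, h⟩ := key (m + k)
  refine ⟨n + m, fun i hi => ?_⟩
  have : m + k < 5 ^ (m + k) := Nat.lt_pow_self (by omega)
  rw [Nat.cast_id, add_assoc]
  generalize hj : m + i = j
  cases j with
  | zero => exact hn.symm
  | succ j =>
    rw [← add_assoc, add_right_comm]
    exact (h j (by omega)).symm

/-- As u has phase 0, two letters put before it stand at offsets 3 and 4 of a block, and offset 3
always carries `a`. -/
theorem eq_a_of_consSeq_consSeq_mem {l l' : Letter}
    (h : consSeq l (consSeq l' tauFix) ∈ tau.subshift ℕ) : l = .a := by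
  obtain ⟨p, hp, y, hy, e⟩ := exists_desubstitution h
  have e' : ∀ i, tauFix i = tauLetter (y ((p + 2 + i) / 5)) ((p + 2 + i) % 5) := fun i => by
    rw [add_assoc, add_comm 2 i]; exact e (i + 2)
  obtain rfl : p = 3 := by
    have := phase_unique (p := 0) (fun i => by rw [zero_add]; exact tauFix_eq i) e'
    omega
  exact (e 0).trans (tauLetter_three _)

theorem isBranchPoint_iff_of_surjective {Y : Type*} {T : Y → Y} (hT : Function.Surjective T)
    {y : Y} : IsBranchPoint T y ↔ ∃ z z', z ≠ z' ∧ T z = y ∧ T z' = y := by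
  constructor
  · intro h
    by_contra! hcon
    obtain ⟨z, hz⟩ := hT y
    exact h ⟨z, hz, fun z' hz' => by_contra fun hne => hcon z' z hne hz' hz⟩
  · rintro ⟨z, z', hne, hz, hz'⟩ h
    exact hne (h.unique hz hz')

/-- The fixed point of `tau` as a point of the subshift. -/
def tauFixPoint : tau.subshift ℕ := ⟨tauFix, tauFix_mem⟩

theorem tau_preimage_tauFixPoint : (tau.sys ℕ) ⁻¹' {tauFixPoint} =
    Set.range fun l => (⟨consSeq l tauFix, consSeq_tauFix_mem l⟩ : tau.subshift ℕ) := by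
  ext ⟨z, hz⟩
  simp only [Set.mem_preimage, Set.mem_singleton_iff, Set.mem_range]
  constructor
  · intro h
    have h : shift z = tauFix := congrArg Subtype.val h
    exact ⟨z 0, Subtype.ext ((congrArg (consSeq (z 0)) h).symm.trans (eq_consSeq_shift z).symm)⟩
  · rintro ⟨l, h⟩
    rw [← h]
    rfl

theorem isBranchPoint_tau_iff (y : tau.subshift ℕ) :
    IsBranchPoint (tau.sys ℕ) y ↔ y = tauFixPoint := by
  rw [isBranchPoint_iff_of_surjective sys_tau_surjective]
  constructor
  · rintro ⟨z, z', hne, rfl, h⟩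
    have h : shift z'.1 = shift z.1 := congrArg Subtype.val h
    refine Subtype.ext (eq_tauFix_of_two_extensions (l := z.1 0) (l' := z'.1 0) ?_ ?_ ?_)
    · intro h0
      refine hne (Subtype.ext ?_)
      rw [eq_consSeq_shift z.1, eq_consSeq_shift z'.1, h, h0]
    · exact (eq_consSeq_shift z.1) ▸ z.2
    · change consSeq (z'.1 0) (shift z.1) ∈ _
      rw [← h]
      exact (eq_consSeq_shift z'.1) ▸ z'.2
  · rintro rfl
    refine ⟨⟨_, consSeq_tauFix_mem .a⟩, ⟨_, consSeq_tauFix_mem .b⟩, fun h => ?_, rfl, rfl⟩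
    exact absurd (congrFun (congrArg Subtype.val h) 0) (by simp [consSeq])

theorem isKBranchPoint_tauFixPoint : IsKBranchPoint 3 (tau.sys ℕ) tauFixPoint := by
  refine ⟨(isBranchPoint_tau_iff _).2 rfl, ?_⟩
  rw [tau_preimage_tauFixPoint, ← Set.image_univ, Function.Injective.encard_image,
    Set.encard_univ, ENat.card_eq_coe_fintype_card]
  · rfl
  · intro l l' h
    exact congrFun (congrArg Subtype.val h) 0

theorem tau_isQuasiInvertible : IsQuasiInvertible (tau.sys ℕ) :=
  ⟨tauFixPoint, (isBranchPoint_tau_iff _).2 rfl, fun y => (isBranchPoint_tau_iff y).1⟩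

/-! ### Decoding the block code. -/

instance : Finite Symb := Finite.of_surjective
  (fun i : Fin 8 => ![Symb.α, .β, .γ, .d, .e, .f, .g, .h] i) fun s => by
    cases s
    exacts [⟨0, rfl⟩, ⟨1, rfl⟩, ⟨2, rfl⟩, ⟨3, rfl⟩, ⟨4, rfl⟩, ⟨5, rfl⟩, ⟨6, rfl⟩, ⟨7, rfl⟩]

/-- The words of length three that local rules send to `α`. -/
def alphaWords : List (Letter × Letter × Letter) := [(.a, .a, .a), (.b, .a, .a), (.a, .c, .a)]

/-- This is what makes the merging harmless: α loses information about its triple, but αα leaves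
only the very first letter in doubt. -/
theorem alphaWords_overlap {w₀ w₁ w₂ w₃ : Letter} (h : (w₀, w₁, w₂) ∈ alphaWords)
    (h' : (w₁, w₂, w₃) ∈ alphaWords) : w₁ = .a ∧ w₂ = .a ∧ w₃ = .a := by
  revert w₀ w₁ w₂ w₃; decide

theorem eq_a_of_mem_alphaWords {x y z : Letter} (h : (x, y, z) ∈ alphaWords) : z = .a := by
  revert x y z; decide

namespace IsLocalRule

variable {φ : Letter → Letter → Letter → Symb} (hφ : IsLocalRule φ)
include hφ

theorem eq_alpha {t : Letter × Letter × Letter} (h : t ∈ alphaWords) :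
    φ t.1 t.2.1 t.2.2 = .α := by
  simp only [alphaWords, List.mem_cons, List.not_mem_nil, or_false] at h
  rcases h with rfl | rfl | rfl
  exacts [hφ.aaa, hφ.baa, hφ.aca]

theorem classify {t : Letter × Letter × Letter} (h : t ∈ tripleWords) :
    (t ∈ alphaWords ∧ φ t.1 t.2.1 t.2.2 = .α) ∨ (t = (.a, .b, .a) ∧ φ t.1 t.2.1 t.2.2 = .β) ∨
      (t = (.c, .a, .a) ∧ φ t.1 t.2.1 t.2.2 = .γ) ∨
      (t ∈ ({(.a, .a, .b), (.a, .b, .c), (.b, .c, .a), (.c, .a, .b), (.b, .a, .c)} :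
          Set (Letter × Letter × Letter)) ∧
        φ t.1 t.2.1 t.2.2 ∈ ({.d, .e, .f, .g, .h} : Set Symb)) := by
  by_cases h1 : t ∈ alphaWords
  · exact Or.inl ⟨h1, hφ.eq_alpha h1⟩
  by_cases h2 : t = (.a, .b, .a)
  · exact Or.inr (Or.inl ⟨h2, by rw [h2]; exact hφ.aba⟩)
  by_cases h3 : t = (.c, .a, .a)
  · exact Or.inr (Or.inr (Or.inl ⟨h3, by rw [h3]; exact hφ.caa⟩))
  have h4 : t ∈ ({(.a, .a, .b), (.a, .b, .c), (.b, .c, .a), (.c, .a, .b), (.b, .a, .c)} :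
      Set (Letter × Letter × Letter)) := by
    simp only [Set.mem_insert_iff, Set.mem_singleton_iff]
    revert h1 h2 h3
    revert t
    decide
  exact Or.inr (Or.inr (Or.inr ⟨h4, hφ.rest.mapsTo h4⟩))

theorem eq_or_mem_alphaWords {s t : Letter × Letter × Letter} (hs : s ∈ tripleWords)
    (ht : t ∈ tripleWords) (h : φ s.1 s.2.1 s.2.2 = φ t.1 t.2.1 t.2.2) :
    s = t ∨ (s ∈ alphaWords ∧ t ∈ alphaWords) := by
  rcases hφ.classify hs with ⟨h1, e1⟩ | ⟨h1, e1⟩ | ⟨h1, e1⟩ | ⟨h1, e1⟩ <;>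
  rcases hφ.classify ht with ⟨h2, e2⟩ | ⟨h2, e2⟩ | ⟨h2, e2⟩ | ⟨h2, e2⟩
  case inr.inr.inr.inr.inr.inr => exact Or.inl (hφ.rest.injOn h1 h2 h)
  all_goals first
    | exact Or.inr ⟨h1, h2⟩
    | exact Or.inl (h1.trans h2.symm)
    | (rw [← h, e1] at e2; simp at e2)
    | (rw [h, e2] at e1; simp at e1)

theorem eq_of_ne_alpha {s t : Letter × Letter × Letter} (hs : s ∈ tripleWords)
    (ht : t ∈ tripleWords) (h : φ s.1 s.2.1 s.2.2 = φ t.1 t.2.1 t.2.2)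
    (hα : φ s.1 s.2.1 s.2.2 ≠ .α) : s = t :=
  (hφ.eq_or_mem_alphaWords hs ht h).resolve_right fun h' => hα (hφ.eq_alpha h'.1)

theorem mem_alphaWords {t : Letter × Letter × Letter} (ht : t ∈ tripleWords)
    (h : φ t.1 t.2.1 t.2.2 = .α) : t ∈ alphaWords := by
  rcases hφ.classify ht with ⟨h1, e1⟩ | ⟨h1, e1⟩ | ⟨h1, e1⟩ | ⟨h1, e1⟩
  · exact h1
  all_goals simp [h] at e1

/-- The merged triples all end in `a`, so the last letter survives; `codeSubstitution` is built on
this. -/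
theorem last_eq {x y z x' y' z' : Letter} (h : (x, y, z) ∈ tripleWords)
    (h' : (x', y', z') ∈ tripleWords) (e : φ x y z = φ x' y' z') : z = z' := by
  rcases hφ.eq_or_mem_alphaWords h h' e with h1 | ⟨h1, h2⟩
  · simp_all
  · rw [eq_a_of_mem_alphaWords h1, eq_a_of_mem_alphaWords h2]

theorem overlap_eq {w₀ w₁ w₂ w₃ v₀ v₁ v₂ v₃ : Letter} (h : (w₀, w₁, w₂) ∈ tripleWords)
    (h' : (w₁, w₂, w₃) ∈ tripleWords) (k : (v₀, v₁, v₂) ∈ tripleWords)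
    (k' : (v₁, v₂, v₃) ∈ tripleWords) (e : φ w₀ w₁ w₂ = φ v₀ v₁ v₂)
    (e' : φ w₁ w₂ w₃ = φ v₁ v₂ v₃) : w₁ = v₁ ∧ w₂ = v₂ := by
  rcases hφ.eq_or_mem_alphaWords h k e with h1 | ⟨h1, h2⟩
  · simp_all
  rcases hφ.eq_or_mem_alphaWords h' k' e' with h3 | ⟨h3, h4⟩
  · simp_all
  have h5 := alphaWords_overlap h1 h3
  have h6 := alphaWords_overlap h2 h4
  simp [h5, h6]

theorem exists_lastLetter :
    ∃ l : Symb → Letter, ∀ x y z, (x, y, z) ∈ tripleWords → l (φ x y z) = z := by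
  classical
  refine ⟨fun s => if h : ∃ t ∈ tripleWords, φ t.1 t.2.1 t.2.2 = s then h.choose.2.2 else .a,
    fun x y z h => ?_⟩
  have hex : ∃ t ∈ tripleWords, φ t.1 t.2.1 t.2.2 = φ x y z := ⟨(x, y, z), h, rfl⟩
  simp only [dif_pos hex]
  exact hφ.last_eq hex.choose_spec.1 h hex.choose_spec.2

theorem exists_decoder : ∃ δ : Symb → Symb → Letter, ∀ w₀ w₁ w₂ w₃,
    (w₀, w₁, w₂) ∈ tripleWords → (w₁, w₂, w₃) ∈ tripleWords →
      δ (φ w₀ w₁ w₂) (φ w₁ w₂ w₃) = w₂ := by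
  classical
  refine ⟨fun s t => if h : ∃ w : Letter × Letter × Letter × Letter,
    ((w.1, w.2.1, w.2.2.1) ∈ tripleWords ∧ (w.2.1, w.2.2.1, w.2.2.2) ∈ tripleWords) ∧
      φ w.1 w.2.1 w.2.2.1 = s ∧ φ w.2.1 w.2.2.1 w.2.2.2 = t then h.choose.2.2.1 else .a,
    fun w₀ w₁ w₂ w₃ h h' => ?_⟩
  have hex : ∃ w : Letter × Letter × Letter × Letter,
    ((w.1, w.2.1, w.2.2.1) ∈ tripleWords ∧ (w.2.1, w.2.2.1, w.2.2.2) ∈ tripleWords) ∧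
      φ w.1 w.2.1 w.2.2.1 = φ w₀ w₁ w₂ ∧ φ w.2.1 w.2.2.1 w.2.2.2 = φ w₁ w₂ w₃ :=
    ⟨(w₀, w₁, w₂, w₃), ⟨h, h'⟩, rfl, rfl⟩
  simp only [dif_pos hex]
  obtain ⟨h1, h2⟩ := hex.choose_spec
  exact (hφ.overlap_eq h1.1 h1.2 h h' h2.1 h2.2).2

theorem exists_triple (s : Symb) :
    ∃ x y z, (x, y, z) ∈ tripleWords ∧ φ x y z = s := by
  have key : s ∈ ({.d, .e, .f, .g, .h} : Set Symb) →
      ∃ x y z, (x, y, z) ∈ tripleWords ∧ φ x y z = s := by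
    intro h
    obtain ⟨⟨x, y, z⟩, ht, e⟩ := hφ.rest.surjOn h
    refine ⟨x, y, z, ?_, e⟩
    simp only [Set.mem_insert_iff, Set.mem_singleton_iff] at ht
    rcases ht with ht | ht | ht | ht | ht <;> rw [ht] <;> decide
  cases s
  · exact ⟨_, _, _, by decide, hφ.aaa⟩
  · exact ⟨_, _, _, by decide, hφ.aba⟩
  · exact ⟨_, _, _, by decide, hφ.caa⟩
  all_goals exact key (by simp)

omit hφ in
theorem blockCodeTwoSided_decode {δ : Symb → Symb → Letter} (hδ : ∀ w₀ w₁ w₂ w₃,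
    (w₀, w₁, w₂) ∈ tripleWords → (w₁, w₂, w₃) ∈ tripleWords →
      δ (φ w₀ w₁ w₂) (φ w₁ w₂ w₃) = w₂) {x : ℤ → Letter} (hx : x ∈ tau.subshift ℤ) (n : ℤ) :
    δ (blockCodeTwoSided φ x (n - 1)) (blockCodeTwoSided φ x n) = x n := by
  have h1 := triple_mem hx (n - 2)
  have h2 := triple_mem hx (n - 1)
  rw [show n - 2 + 1 = n - 1 by ring, show n - 2 + 2 = n by ring] at h1
  rw [show n - 1 + 1 = n by ring, show n - 1 + 2 = n + 1 by ring] at h2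
  have := hδ _ _ _ _ h1 h2
  rwa [blockCodeTwoSided, blockCodeTwoSided, show n - 1 - 1 = n - 2 by ring,
    show n - 1 + 1 = n by ring]

theorem injOn_blockCodeTwoSided : Set.InjOn (blockCodeTwoSided φ) (tau.subshift ℤ) := by
  obtain ⟨δ, hδ⟩ := hφ.exists_decoder
  intro x hx y hy h
  funext n
  rw [← blockCodeTwoSided_decode hδ hx, ← blockCodeTwoSided_decode hδ hy, h]

theorem image_blockCodeTwoSided : blockCodeTwoSided φ '' tau.subshift ℤ =
    subshiftOf ℤ (seqLang (blockCodeOneSided φ tauFix)) := by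
  obtain ⟨δ, hδ⟩ := hφ.exists_decoder
  ext y
  rw [mem_subshiftOf_seqLang_iff]
  constructor
  · rintro ⟨x, hx, rfl⟩ m k
    obtain ⟨n, h⟩ := mem_tau_subshift_iff.1 hx (m - 1) (k + 2)
    refine ⟨n, fun i hi => ?_⟩
    have h0 := h i (by omega)
    have h1 := h (i + 1) (by omega)
    have h2 := h (i + 2) (by omega)
    rw [blockCodeTwoSided, blockCodeOneSided, Nat.cast_id, add_assoc n, add_assoc n, ← h0, ← h1,
      ← h2]
    push_cast
    congr 2 <;> ring
  · intro h
    have hdec : ∀ n, δ (blockCodeOneSided φ tauFix n) (blockCodeOneSided φ tauFix (n + 1)) =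
        tauFix (n + 2) := fun n =>
      hδ _ _ _ _ (tauFix_triple n) (tauFix_triple (n + 1))
    have key : ∀ (m : ℤ) (k : ℕ), ∃ n : ℕ,
        (∀ i < k, y (m + i) = blockCodeOneSided φ tauFix (n + i)) ∧
        ∀ i < k, δ (y (m + i - 1)) (y (m + i)) = tauFix (n + i + 1) := by
      intro m k
      -- The window starts one place early because decoding at m also needs the symbol at m - 1.
      obtain ⟨n, hn⟩ := h (m - 1) (k + 1)
      refine ⟨n + 1, fun i hi => ?_, fun i hi => ?_⟩
      · have := hn (i + 1) (by omega)
        rw [Nat.cast_id] at this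
        rw [add_assoc, add_comm 1 i, ← this]
        push_cast
        congr 1
        ring
      · have h0 := hn i (by omega)
        have h1 := hn (i + 1) (by omega)
        rw [show n + 1 + i + 1 = n + i + 2 by ring, ← hdec, show n + i + 1 = n + (i + 1) by ring]
        simp only [Nat.cast_id] at h0 h1
        rw [← h0, ← h1]
        push_cast
        congr 2 <;> ring
    refine ⟨fun n => δ (y (n - 1)) (y n), ?_, ?_⟩
    · refine mem_tau_subshift_iff.2 fun m k => ?_
      obtain ⟨n, -, hn⟩ := key m k
      exact ⟨n + 1, fun i hi => by rw [hn i hi, add_right_comm]⟩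
    · funext z
      obtain ⟨n, h1, h2⟩ := key (z - 1) 3
      have e1 := h1 1 (by omega)
      have d0 := h2 0 (by omega)
      have d1 := h2 1 (by omega)
      have d2 := h2 2 (by omega)
      push_cast at e1 d0 d1 d2
      rw [show z - 1 + 0 = z - 1 by ring] at d0
      rw [show z - 1 + 1 = z by ring] at d1 e1
      rw [show z - 1 + 2 = z + 1 by ring] at d2
      simp only [blockCodeTwoSided]
      rw [d0, d1, d2, e1]
      rfl

end IsLocalRule

/-! ### A minimal substitution for the image. -/

/-- The letter at position `i < 25` of `tau (tau x)`; this word is always followed by `aa`, which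
gives the values at `25` and `26`. -/
def tauSqLetter (x : Letter) (i : ℕ) : Letter := tauLetter (tauLetter x (i / 5)) (i % 5)

theorem tauFix_tauSqLetter (q : ℕ) {i : ℕ} (hi : i < 27) :
    tauFix (25 * q + i) = tauSqLetter (tauFix q) i := by
  rw [tauFix_eq, tauFix_eq ((25 * q + i) / 5)]
  rcases lt_or_ge i 25 with h | h
  · rw [tauSqLetter, show (25 * q + i) / 5 / 5 = q by omega,
      show (25 * q + i) / 5 % 5 = i / 5 by omega, show (25 * q + i) % 5 = i % 5 by omega]
  -- For i = 25, 26 the right side uses the default value `a` of `tauLetter x 5`, which agrees with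
  -- the first letter of every block.
  · rw [tauSqLetter, show (25 * q + i) / 5 % 5 = 0 by omega,
      show (25 * q + i) % 5 = i % 5 by omega, show i / 5 = 5 by omega, tauLetter_zero]
    cases tauFix q <;> rfl

/-- The substitution of constant length `25` that sends a symbol with last letter `x` to the code
of `tau (tau x) aa`. -/
def codeSubstitution (φ : Letter → Letter → Letter → Symb) (l : Symb → Letter) :
    Substitution Symb where
  toFun s := (List.range 25).map fun i =>
    φ (tauSqLetter (l s) i) (tauSqLetter (l s) (i + 1)) (tauSqLetter (l s) (i + 2))
  ne_nil s := by simp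

theorem length_codeSubstitution (φ : Letter → Letter → Letter → Symb) (l : Symb → Letter)
    (s : Symb) : ((codeSubstitution φ l).toFun s).length = 25 := by
  simp [codeSubstitution]

namespace IsLocalRule

variable {φ : Letter → Letter → Letter → Symb} (hφ : IsLocalRule φ) {l : Symb → Letter}
  (hl : ∀ x y z, (x, y, z) ∈ tripleWords → l (φ x y z) = z)

include hl

/-- The symbol at n has last letter u (n + 2), so its image codes the block of u that starts at 25 *
(n + 2). Thus Φ(u) is fixed only up to a shift by 50. -/
theorem codeSubstitution_onSeq : (codeSubstitution φ l).onSeq (blockCodeOneSided φ tauFix) =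
    fun n => blockCodeOneSided φ tauFix (n + 50) := by
  rw [Substitution.eq_onSeq_iff (length_codeSubstitution φ l) (by omega)]
  intro n
  have hlast : l (blockCodeOneSided φ tauFix (n / 25)) = tauFix (n / 25 + 2) :=
    hl _ _ _ (tauFix_triple _)
  have h : n % 25 < 25 := Nat.mod_lt _ (by omega)
  simp only [codeSubstitution, List.getElem?_map, List.getElem?_range h, Option.map_some, hlast]
  rw [← tauFix_tauSqLetter _ (by omega), ← tauFix_tauSqLetter _ (by omega),
    ← tauFix_tauSqLetter _ (by omega), blockCodeOneSided]
  have : 25 * (n / 25 + 2) + n % 25 = n + 50 := by omega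
  rw [← add_assoc, ← add_assoc, this]

theorem codeSubstitution_iterate (n m : ℕ) : ∃ m',
    (codeSubstitution φ l).onWord^[n] [blockCodeOneSided φ tauFix m] =
      wordAt (blockCodeOneSided φ tauFix) m' (25 ^ n) := by
  induction n with
  | zero => exact ⟨m, by simp [wordAt]⟩
  | succ n ih =>
    obtain ⟨m', h⟩ := ih
    refine ⟨25 * m' + 50, ?_⟩
    rw [Function.iterate_succ_apply', h,
      Substitution.onWord_wordAt (length_codeSubstitution φ l), codeSubstitution_onSeq hl, pow_succ',
      wordAt_eq_iff]
    intro i _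
    simp [add_right_comm]

include hφ

/-- Every image begins with the code of aab, and the image of that symbol codes `tau (tau b) aa`,
which contains all triples. -/
theorem codeSubstitution_primitive (s t : Symb) : t ∈ (codeSubstitution φ l).onWord^[2] [s] := by
  have h1 : φ .a .a .b ∈ (codeSubstitution φ l).toFun s := by
    refine List.mem_map.2 ⟨0, by simp, ?_⟩
    generalize l s = x
    cases x <;> rfl
  have h2 : t ∈ (codeSubstitution φ l).toFun (φ .a .a .b) := by
    obtain ⟨x, y, z, h, rfl⟩ := hφ.exists_triple t
    have : ∃ i ∈ List.range 25,
        (tauSqLetter .b i, tauSqLetter .b (i + 1), tauSqLetter .b (i + 2)) = (x, y, z) := by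
      revert x y z; decide
    obtain ⟨i, hi, e⟩ := this
    refine List.mem_map.2 ⟨i, hi, ?_⟩
    rw [hl _ _ _ (by decide)]
    simp only [Prod.mk.injEq] at e
    rw [e.1, e.2.1, e.2.2]
  change t ∈ (codeSubstitution φ l).onWord ((codeSubstitution φ l).onWord [s])
  rw [Substitution.onWord_singleton]
  exact List.mem_flatMap.2 ⟨_, h1, h2⟩

omit hφ in
-- Here the square of `tau` matters: with `tau` alone the codes of aab and abc would be each other's
-- first symbols, and no symbol would begin its own image.
theorem codeSubstitution_fixed :
    (codeSubstitution φ l).onSeq ((codeSubstitution φ l).fixedSeq 25 (φ .a .a .b)) =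
      (codeSubstitution φ l).fixedSeq 25 (φ .a .a .b) := by
  refine Substitution.onSeq_fixedSeq _ (length_codeSubstitution φ l) (by omega) ?_
  simp only [codeSubstitution, List.getElem?_map, List.getElem?_range (show 0 < 25 by omega),
    Option.map_some]
  rw [hl _ _ _ (by decide)]
  rfl

theorem codeSubstitution_isMinimal : (codeSubstitution φ l).IsMinimal :=
  Substitution.isMinimal_of_primitive (length_codeSubstitution φ l) (by omega)
    (codeSubstitution_fixed hl) (codeSubstitution_primitive hφ hl)

/-- Since Φ(u) is not the fixed point, the languages are compared through iterates: these are
windows of Φ(u), and long ones contain every word of Φ(u) by uniform recurrence of u. -/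
theorem codeSubstitution_lang :
    (codeSubstitution φ l).lang = seqLang (blockCodeOneSided φ tauFix) := by
  ext w
  constructor
  · rintro ⟨n, -, s, h⟩
    obtain ⟨x, y, z, hxyz, rfl⟩ := hφ.exists_triple s
    obtain ⟨m, rfl, rfl, rfl⟩ := exists_tauFix_triple hxyz
    obtain ⟨m', e⟩ := codeSubstitution_iterate hl n m
    change w <:+: (codeSubstitution φ l).onWord^[n] [blockCodeOneSided φ tauFix m] at h
    rw [e] at h
    obtain ⟨j, -, hj⟩ := exists_wordAt_of_infix h
    exact ⟨_, _, hj⟩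
  · rintro ⟨m, k, rfl⟩
    have hw : wordAt tauFix m (k + 2) ∈ tau.lang := by rw [tau_lang]; exact ⟨m, _, rfl⟩
    obtain ⟨K, hK⟩ := Substitution.exists_infix_of_mem_lang length_tau (by omega) onSeq_tauFix
      tau_primitive hw
    obtain ⟨m', e⟩ := codeSubstitution_iterate hl (K + 1) 0
    refine ⟨K + 1, by omega, blockCodeOneSided φ tauFix 0, ?_⟩
    rw [e]
    obtain ⟨j, hjK, hj⟩ := exists_wordAt_of_infix (hK m')
    rw [length_wordAt] at hj hjK
    rw [wordAt_eq_iff] at hj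
    have hKlt : K + 1 < 25 ^ (K + 1) := Nat.lt_pow_self (by omega)
    have : wordAt (blockCodeOneSided φ tauFix) m k =
        wordAt (blockCodeOneSided φ tauFix) (m' + j) k := by
      rw [wordAt_eq_iff]
      intro i hi
      have h0 := hj i (by omega)
      have h1 := hj (i + 1) (by omega)
      have h2 := hj (i + 2) (by omega)
      simp only [Nat.cast_id, ← add_assoc] at h0 h1 h2
      simp only [Nat.cast_id, blockCodeOneSided]
      rw [h0, h1, h2]
    rw [this]
    exact wordAt_infix _ (by omega) (by omega)

end IsLocalRule

theorem IsLocalRule.exists_substitution {φ : Letter → Letter → Letter → Symb}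
    (hφ : IsLocalRule φ) : ∃ τ' : Substitution Symb, τ'.IsMinimal ∧
      blockCodeTwoSided φ '' tau.subshift ℤ = τ'.subshift ℤ := by
  obtain ⟨l, hl⟩ := hφ.exists_lastLetter
  refine ⟨codeSubstitution φ l, codeSubstitution_isMinimal hφ hl, ?_⟩
  rw [hφ.image_blockCodeTwoSided, Substitution.subshift, codeSubstitution_lang hφ hl]

/-! ### Branch points of the one-sided image and non-conjugacy. -/

theorem IsBranchPoint.map_conjugacy {X Y : Type*} {S : X → X} {T : Y → Y} (e : X ≃ Y)
    (h : Function.Semiconj e S T) {y : Y} (hy : IsBranchPoint T y) :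
    IsBranchPoint S (e.symm y) := by
  rintro ⟨z, hz, huniq⟩
  refine hy ⟨e z, (h z).symm.trans (by rw [hz, e.apply_symm_apply]), fun w hw => ?_⟩
  rw [← huniq (e.symm w), e.apply_symm_apply]
  apply e.injective
  rw [h, e.apply_symm_apply, e.apply_symm_apply, hw]

theorem shift_blockCodeTwoSided {A B : Type*} (φ : A → A → A → B) (x : ℤ → A) :
    blockCodeTwoSided φ (shift x) = shift (blockCodeTwoSided φ x) := by
  funext n
  simp [blockCodeTwoSided, shift]

theorem blockCodeOneSided_consSeq {A B : Type*} (φ : A → A → A → B) (s : A) (x : ℕ → A) :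
    blockCodeOneSided φ (consSeq s x) = consSeq (φ s (x 0) (x 1)) (blockCodeOneSided φ x) := by
  funext n
  cases n <;> rfl

theorem triple_mem_nat {x : ℕ → Letter} (hx : x ∈ tau.subshift ℕ) (n : ℕ) :
    (x n, x (n + 1), x (n + 2)) ∈ tripleWords :=
  triple_mem hx n

namespace IsLocalRule

variable {φ : Letter → Letter → Letter → Symb} (hφ : IsLocalRule φ) {τ' : Substitution Symb}

theorem areConjugate_twoSided (hφ : IsLocalRule φ)
    (h : blockCodeTwoSided φ '' tau.subshift ℤ = τ'.subshift ℤ) :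
    AreConjugate (tau.sys ℤ) (τ'.sys ℤ) := by
  have hb : Set.BijOn (blockCodeTwoSided φ) (tau.subshift ℤ) (τ'.subshift ℤ) :=
    h ▸ hφ.injOn_blockCodeTwoSided.bijOn_image
  have hc : Continuous (blockCodeTwoSided φ) := by
    refine continuous_pi fun n => ?_
    have h3 : Continuous fun p : Letter × Letter × Letter => φ p.1 p.2.1 p.2.2 :=
      continuous_of_discreteTopology
    exact h3.comp (f := fun x : ℤ → Letter => (x (n - 1), x n, x (n + 1))) (by fun_prop)
  have hc' : Continuous hb.equiv := (hc.comp continuous_subtype_val).subtype_mk _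
  refine ⟨hc'.homeoOfEquivCompactToT2, fun x => Subtype.ext ?_⟩
  exact shift_blockCodeTwoSided φ x.1

/-- Both one-sided shifts are surjective, so their points are right halves of two-sided points,
where the image is known. The restrictions at -1 and 1 compensate for the centring of the two-sided
code. -/
theorem subshift_nat_eq (hmin : τ'.IsMinimal)
    (h : blockCodeTwoSided φ '' tau.subshift ℤ = τ'.subshift ℤ) :
    τ'.subshift ℕ = blockCodeOneSided φ '' tau.subshift ℕ := by
  ext y
  constructor
  · intro hy
    obtain ⟨Y, hY, e⟩ := Substitution.exists_extension_of_surjective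
      (Substitution.surjective_of_isMinimalMap hmin.2) hy
    rw [← h] at hY
    obtain ⟨X, hX, rfl⟩ := hY
    refine ⟨_, Substitution.restrict_mem hX (-1), ?_⟩
    funext n
    rw [← e, blockCodeTwoSided, blockCodeOneSided]
    push_cast
    congr 2 <;> ring
  · rintro ⟨x, hx, rfl⟩
    obtain ⟨X, hX, e⟩ := Substitution.exists_extension_of_surjective sys_tau_surjective hx
    have hY : blockCodeTwoSided φ X ∈ τ'.subshift ℤ := h ▸ ⟨X, hX, rfl⟩
    convert Substitution.restrict_mem hY 1 using 1
    funext n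
    rw [blockCodeOneSided, blockCodeTwoSided, ← e, ← e, ← e]
    push_cast
    congr 2 <;> ring

include hφ

theorem tail_eq {x x' : ℕ → Letter} (hx : x ∈ tau.subshift ℕ) (hx' : x' ∈ tau.subshift ℕ)
    (h : blockCodeOneSided φ x = blockCodeOneSided φ x') : shift x = shift x' := by
  funext n
  exact (hφ.overlap_eq (triple_mem_nat hx n) (triple_mem_nat hx (n + 1)) (triple_mem_nat hx' n)
    (triple_mem_nat hx' (n + 1)) (congrFun h n) (congrFun h (n + 1))).1

theorem code_aab_ne : φ .a .a .b ≠ .α := by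
  intro h
  exact absurd (hφ.mem_alphaWords (t := (.a, .a, .b)) (by decide) h) (by decide)

/-- Only the first letter could be lost, and the code of u begins with the code of aab, which is not
merged with any other triple. -/
theorem eq_tauFix_of_code_eq {x : ℕ → Letter} (hx : x ∈ tau.subshift ℕ)
    (h : blockCodeOneSided φ x = blockCodeOneSided φ tauFix) : x = tauFix := by
  have h0 := congrFun h 0
  have hu := triple_mem_nat tauFix_mem 0
  have e : φ (tauFix 0) (tauFix 1) (tauFix 2) = φ .a .a .b := by
    rw [tauFix_zero, tauFix_one, tauFix_two]
  have h1 := hφ.eq_of_ne_alpha hu (triple_mem_nat hx 0) h0.symm (by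
    change φ (tauFix 0) (tauFix 1) (tauFix 2) ≠ .α
    rw [e]; exact hφ.code_aab_ne)
  rw [eq_consSeq_shift x, eq_consSeq_shift tauFix, hφ.tail_eq hx tauFix_mem h]
  rw [(Prod.mk.inj h1).1]

theorem letters_of_code_eq {s t : Letter} (hst : s ≠ t) (h : φ s .a .a = φ t .a .a) :
    φ s .a .a = .α := by
  by_contra hα
  have h1 := hφ.eq_of_ne_alpha (s := (s, .a, .a)) (t := (t, .a, .a))
    (by cases s <;> decide) (by cases t <;> decide) h hα
  exact hst (Prod.mk.inj h1).1

omit hφ in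
theorem exists_code_preimage (hX : τ'.subshift ℕ = blockCodeOneSided φ '' tau.subshift ℕ)
    (z : τ'.subshift ℕ) : ∃ x ∈ tau.subshift ℕ, blockCodeOneSided φ x = z.1 :=
  hX.subset z.2

theorem preimage_code_tauFix (hX : τ'.subshift ℕ = blockCodeOneSided φ '' tau.subshift ℕ)
    (z : ℕ → Symb) : (z ∈ τ'.subshift ℕ ∧ shift z = blockCodeOneSided φ tauFix) ↔
      z = consSeq .α (blockCodeOneSided φ tauFix) ∨
        z = consSeq .γ (blockCodeOneSided φ tauFix) := by
  rw [hX]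
  constructor
  · rintro ⟨⟨x, hx, rfl⟩, h⟩
    have hs : shift x = tauFix := hφ.eq_tauFix_of_code_eq (tau.shift_mem hx) h
    rw [eq_consSeq_shift x, hs, blockCodeOneSided_consSeq, tauFix_zero, tauFix_one]
    generalize x 0 = s
    cases s
    · exact Or.inl (by rw [hφ.aaa])
    · exact Or.inl (by rw [hφ.baa])
    · exact Or.inr (by rw [hφ.caa])
  · rintro (rfl | rfl)
    · refine ⟨⟨_, consSeq_tauFix_mem .a, ?_⟩, rfl⟩
      rw [blockCodeOneSided_consSeq, tauFix_zero, tauFix_one, hφ.aaa]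
    · refine ⟨⟨_, consSeq_tauFix_mem .c, ?_⟩, rfl⟩
      rw [blockCodeOneSided_consSeq, tauFix_zero, tauFix_one, hφ.caa]

theorem preimage_consSeq_code_tauFix
    (hX : τ'.subshift ℕ = blockCodeOneSided φ '' tau.subshift ℕ) (z : ℕ → Symb) :
    (z ∈ τ'.subshift ℕ ∧ shift z = consSeq .α (blockCodeOneSided φ tauFix)) ↔
      z = consSeq .α (consSeq .α (blockCodeOneSided φ tauFix)) ∨
        z = consSeq .β (consSeq .α (blockCodeOneSided φ tauFix)) := by
  -- Surjectivity provides some letter before su, and its phase forces it to be `a`.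
  have hmem : ∀ s : Letter, consSeq .a (consSeq s tauFix) ∈ tau.subshift ℕ := fun s => by
    obtain ⟨w, hw⟩ := sys_tau_surjective ⟨_, consSeq_tauFix_mem s⟩
    have hw : shift w.1 = consSeq s tauFix := congrArg Subtype.val hw
    have h := w.2
    rw [eq_consSeq_shift w.1, hw] at h
    rwa [eq_a_of_consSeq_consSeq_mem h] at h
  rw [hX]
  constructor
  · rintro ⟨⟨x, hx, rfl⟩, h⟩
    have hs : shift (shift x) = tauFix :=
      hφ.eq_tauFix_of_code_eq (tau.shift_mem (tau.shift_mem hx)) (congrArg shift h)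
    have hx2 : x = consSeq (x 0) (consSeq (x 1) tauFix) := by
      rw [← hs]
      exact (eq_consSeq_shift x).trans (congrArg _ (eq_consSeq_shift _))
    have h1 := congrFun h 0
    change φ (x 1) (shift (shift x) 0) (shift (shift x) 1) = .α at h1
    rw [hs, tauFix_zero, tauFix_one] at h1
    rw [hx2] at hx
    have h0 := eq_a_of_consSeq_consSeq_mem hx
    rw [hx2, h0, blockCodeOneSided_consSeq, blockCodeOneSided_consSeq, tauFix_zero, tauFix_one, h1]
    simp only [consSeq, tauFix_zero]
    revert h1
    generalize x 1 = s
    cases s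
    · exact fun _ => Or.inl (by rw [hφ.aaa])
    · exact fun _ => Or.inr (by rw [hφ.aba])
    · rw [hφ.caa]; simp
  · rintro (rfl | rfl)
    · refine ⟨⟨_, hmem .a, ?_⟩, rfl⟩
      rw [blockCodeOneSided_consSeq, blockCodeOneSided_consSeq, tauFix_zero, tauFix_one, hφ.aaa]
      simp only [consSeq, tauFix_zero, hφ.aaa]
    · refine ⟨⟨_, hmem .b, ?_⟩, rfl⟩
      rw [blockCodeOneSided_consSeq, blockCodeOneSided_consSeq, tauFix_zero, tauFix_one, hφ.baa]
      simp only [consSeq, tauFix_zero, hφ.aba]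

omit hφ in
theorem isKBranchPoint_two {y : τ'.subshift ℕ} {s t : Symb} (hst : s ≠ t)
    (h : ∀ z : ℕ → Symb, (z ∈ τ'.subshift ℕ ∧ shift z = y.1) ↔
      z = consSeq s y.1 ∨ z = consSeq t y.1) : IsKBranchPoint 2 (τ'.sys ℕ) y := by
  have hs := ((h _).2 (Or.inl rfl)).1
  have ht := ((h _).2 (Or.inr rfl)).1
  have hne : (⟨_, hs⟩ : τ'.subshift ℕ) ≠ ⟨_, ht⟩ := fun e =>
    hst (congrFun (congrArg Subtype.val e) 0)
  refine ⟨fun hu => hne (hu.unique (Subtype.ext rfl) (Subtype.ext rfl)), ?_⟩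
  have hpre : (τ'.sys ℕ) ⁻¹' {y} = {⟨_, hs⟩, ⟨_, ht⟩} := by
    ext ⟨z, hz⟩
    simp only [Set.mem_preimage, Set.mem_singleton_iff, Set.mem_insert_iff, Subtype.mk.injEq]
    rw [← h z]
    exact ⟨fun e => ⟨hz, congrArg Subtype.val e⟩, fun e => Subtype.ext e.2⟩
  rw [hpre, Set.encard_pair hne]
  rfl

theorem branchPoint_cases (hX : τ'.subshift ℕ = blockCodeOneSided φ '' tau.subshift ℕ)
    (hsurj : Function.Surjective (τ'.sys ℕ)) {y : τ'.subshift ℕ}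
    (hy : IsBranchPoint (τ'.sys ℕ) y) : y.1 = blockCodeOneSided φ tauFix ∨
      y.1 = consSeq .α (blockCodeOneSided φ tauFix) := by
  rw [isBranchPoint_iff_of_surjective hsurj] at hy
  obtain ⟨z, z', hne, hz, hz'⟩ := hy
  obtain ⟨x, hx, e⟩ := exists_code_preimage hX z
  obtain ⟨x', hx', e'⟩ := exists_code_preimage hX z'
  have hy1 : blockCodeOneSided φ (shift x) = y.1 := by
    rw [← hz]; change shift (blockCodeOneSided φ x) = shift z.1; rw [e]
  have hy2 : blockCodeOneSided φ (shift x') = y.1 := by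
    rw [← hz']; change shift (blockCodeOneSided φ x') = shift z'.1; rw [e']
  have hxx : x ≠ x' := by
    rintro rfl
    exact hne (Subtype.ext (e.symm.trans e'))
  have key : ∀ {w w' : ℕ → Letter}, w ∈ tau.subshift ℕ → w' ∈ tau.subshift ℕ → w ≠ w' →
      shift w = shift w' → w 0 ≠ w' 0 ∧ shift w = tauFix := by
    intro w w' hw hw' hww hs
    have h0 : w 0 ≠ w' 0 := fun h0 =>
      hww (by rw [eq_consSeq_shift w, eq_consSeq_shift w', h0, hs])
    rw [eq_consSeq_shift w] at hw
    rw [eq_consSeq_shift w', ← hs] at hw'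
    exact ⟨h0, eq_tauFix_of_two_extensions h0 hw hw'⟩
  -- Either x and x' differ in their first letter only, so that the common tail is u, or their
  -- shifts have the same code but differ in the first letter. Then the tail after two letters is u,
  -- and two distinct letters before it receive the same symbol, necessarily α.
  by_cases hs : shift x = shift x'
  · left
    rw [← hy1, (key hx hx' hxx hs).2]
  · right
    have hsx := tau.shift_mem hx
    have hsx' := tau.shift_mem hx'
    have hss := hφ.tail_eq hsx hsx' (hy1.trans hy2.symm)
    obtain ⟨h0, hu⟩ := key hsx hsx' hs hss
    have h1 := hy1
    have h2 := hy2
    rw [eq_consSeq_shift (shift x), hu, blockCodeOneSided_consSeq, tauFix_zero, tauFix_one] at h1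
    rw [eq_consSeq_shift (shift x'), ← hss, hu, blockCodeOneSided_consSeq, tauFix_zero,
      tauFix_one] at h2
    have h3 := congrFun (h1.trans h2.symm) 0
    rw [← h1, hφ.letters_of_code_eq h0 h3]

theorem branchPoints_oneSided (hmin : τ'.IsMinimal)
    (h : blockCodeTwoSided φ '' tau.subshift ℤ = τ'.subshift ℤ) :
    ∃ y₁ y₂ : τ'.subshift ℕ, y₁ ≠ y₂ ∧ y₁.1 = blockCodeOneSided φ tauFix ∧
      y₂.1 = consSeq Symb.α (blockCodeOneSided φ tauFix) ∧
      IsKBranchPoint 2 (τ'.sys ℕ) y₁ ∧ IsKBranchPoint 2 (τ'.sys ℕ) y₂ ∧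
      ∀ y, IsBranchPoint (τ'.sys ℕ) y → y = y₁ ∨ y = y₂ := by
  have hX := subshift_nat_eq hmin h
  have m1 : blockCodeOneSided φ tauFix ∈ τ'.subshift ℕ := hX ▸ ⟨_, tauFix_mem, rfl⟩
  have m2 := ((hφ.preimage_code_tauFix hX _).2 (Or.inl rfl)).1
  refine ⟨⟨_, m1⟩, ⟨_, m2⟩, ?_, rfl, rfl,
    isKBranchPoint_two (by simp) (hφ.preimage_code_tauFix hX),
    isKBranchPoint_two (by simp) (hφ.preimage_consSeq_code_tauFix hX), fun y hy => ?_⟩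
  · intro e
    have := congrFun (congrArg Subtype.val e) 0
    change φ (tauFix 0) (tauFix 1) (tauFix 2) = .α at this
    rw [tauFix_zero, tauFix_one, tauFix_two] at this
    exact hφ.code_aab_ne this
  · rcases hφ.branchPoint_cases hX (Substitution.surjective_of_isMinimalMap hmin.2) hy with e | e
    · exact Or.inl (Subtype.ext e)
    · exact Or.inr (Subtype.ext e)

theorem not_areConjugate_oneSided (hmin : τ'.IsMinimal)
    (h : blockCodeTwoSided φ '' tau.subshift ℤ = τ'.subshift ℤ) :
    ¬ AreConjugate (tau.sys ℕ) (τ'.sys ℕ) := by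
  rintro ⟨e, he⟩
  obtain ⟨y₁, y₂, hne, -, -, h1, h2, -⟩ := hφ.branchPoints_oneSided hmin h
  have e1 := (isBranchPoint_tau_iff _).1 (h1.1.map_conjugacy e.toEquiv he)
  have e2 := (isBranchPoint_tau_iff _).1 (h2.1.map_conjugacy e.toEquiv he)
  exact hne (e.toEquiv.symm.injective (e1.trans e2.symm))

end IsLocalRule

theorem mainTheorem8 :
    -- the substitution `tau`, its words of length three, and its one-sided subshift
    tau.IsMinimal ∧
    {w | w ∈ tau.lang ∧ w.length = 3} =
      {[.a, .a, .b], [.a, .b, .a], [.b, .a, .a], [.a, .a, .a], [.a, .b, .c], [.b, .c, .a],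
        [.c, .a, .b], [.b, .a, .c], [.a, .c, .a], [.c, .a, .a]} ∧
    IsQuasiInvertible (tau.sys ℕ) ∧
    ∃ u : tau.subshift ℕ,
      u.1 0 = Letter.a ∧ (∀ x, tau.onSeq x = x ↔ x = u.1) ∧
      IsKBranchPoint 3 (tau.sys ℕ) u ∧
      ∀ φ : Letter → Letter → Letter → Symb, IsLocalRule φ →
        Set.InjOn (blockCodeTwoSided φ) (tau.subshift ℤ) ∧
        -- the image is generated by a substitution
        (∃ τ' : Substitution Symb, τ'.IsMinimal ∧
          blockCodeTwoSided φ '' tau.subshift ℤ = τ'.subshift ℤ) ∧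
        -- what holds for every substitution that generates the image
        ∀ τ' : Substitution Symb, τ'.IsMinimal →
          blockCodeTwoSided φ '' tau.subshift ℤ = τ'.subshift ℤ →
          AreConjugate (tau.sys ℤ) (τ'.sys ℤ) ∧
          (∃ y₁ y₂ : τ'.subshift ℕ, y₁ ≠ y₂ ∧
            y₁.1 = blockCodeOneSided φ u.1 ∧
            y₂.1 = consSeq Symb.α (blockCodeOneSided φ u.1) ∧
            IsKBranchPoint 2 (τ'.sys ℕ) y₁ ∧ IsKBranchPoint 2 (τ'.sys ℕ) y₂ ∧
            ∀ y, IsBranchPoint (τ'.sys ℕ) y → y = y₁ ∨ y = y₂) ∧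
          ¬ AreConjugate (tau.sys ℕ) (τ'.sys ℕ) := by
  refine ⟨tau_isMinimal, tau_lang_three, tau_isQuasiInvertible, tauFixPoint, tauFix_zero,
    fun x => onSeq_tau_eq_self_iff, isKBranchPoint_tauFixPoint, fun φ hφ =>
    ⟨hφ.injOn_blockCodeTwoSided, hφ.exists_substitution, fun τ' hmin h =>
      ⟨hφ.areConjugate_twoSided h, hφ.branchPoints_oneSided hmin h,
        hφ.not_areConjugate_oneSided hmin h⟩⟩⟩
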